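/- For a finite simple graph $H=(V,E)$ with $m=e(H)\ge 1$ edges and a partition $\mathcal A$ of $V$, let $$q_{\mathcal A}(H)=\frac1{2m}\sum_{A\in\mathcal A}\ \sum_{u,v\in A}\Bigl(\mathbf 1_{uv\in E}-\frac{\deg(u)\deg(v)}{2m}\Bigr)$$ (the inner sum over ordered pairs), let $q_{\mathcal A}(H)=0$ if $H$ has no edges, let $q^*(H)=\max_{\mathcal A}q_{\mathcal A}(H)$ over all partitions of $V$, and let $\delta_{\mathcal A}(H)=q^*(H)-q_{\mathcal A}(H)$. For a graph $G$ and $0<p\le 1$ let $G_p$ be the random subgraph of $G$ on the same vertex set in which each edge of $G$ is kept independently with probability $p$. Let $v(G)$ be the number of vertices of $G$. There is a function $c=c(\varepsilon)$ with $c(\varepsilon)=\Theta\bigl(\varepsilon^{-3}\log\varepsilon^{-1}\bigr)$ as $\varepsilon\to0^+$ such that the following holds for each $\varepsilon>0$. There is an algorithm, depending only on $\varepsilon$, which takes as input a graph $H$ (as a list of edges) and a partition $\mathcal A$ of its vertex set (as a labelling of the vertices), and on every such input outputs a partition $\mathcal A'=\mathcal A'(H,\mathcal A)$ of the vertex set within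 a number of operations of a unit-cost random access machine (with addition and subtraction) that is linear in $v(H)+e(H)$ (with a constant that may depend on $\varepsilon$), such that, for every graph $G$ and every $p\in(0,1]$ with $e(G)p/v(G)\ge c(\varepsilon)$, with probability at least $1-\varepsilon$ both of the following hold: (a) $|q^*(G_p)-q^*(G)|<\varepsilon$; and (b) for every partition $\mathcal A$ of the vertex set, the output $\mathcal A'$ of the algorithm on $(G_p,\mathcal A)$ satisfies $\delta_{\mathcal A'}(G)\le\delta_{\mathcal A}(G_p)+\varepsilon$. -/

import Mathlib

open Filter Topology Asymptotics

namespace SampledModularity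

/-! ### Modularity of a finite graph -/

section Modularity

variable {V : Type*} [Fintype V] [DecidableEq V]

open scoped Classical in
/-- The number of edges `e(G)`. -/
noncomputable def numEdges (G : SimpleGraph V) : ℕ := G.edgeFinset.card

open scoped Classical in
/-- The modularity score
`q_A(G) = (1 / 2m) ∑_{A ∈ 𝒜} ∑_{u, v ∈ A} (1_{uv ∈ E} - deg u * deg v / 2m)`
of a vertex partition `𝒜`, where `m = e(G)` and `(u, v)` runs over ordered pairs; by convention the
score is `0` if `G` has no edge. -/
noncomputable def modularityScore (G : SimpleGraph V)
    (A : Finpartition (Finset.univ : Finset V)) : ℝ :=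
  if numEdges G = 0 then 0 else
    1 / (2 * (numEdges G : ℝ)) *
      ∑ S ∈ A.parts, ∑ u ∈ S, ∑ v ∈ S,
        ((if G.Adj u v then (1 : ℝ) else 0) -
          (G.degree u : ℝ) * (G.degree v : ℝ) / (2 * (numEdges G : ℝ)))

/-- The modularity `q^*(G)`: the maximum of the score over all vertex partitions (there are finitely
many of them and at least one, so that this supremum is a maximum). -/
noncomputable def modularity (G : SimpleGraph V) : ℝ :=
  ⨆ A : Finpartition (Finset.univ : Finset V), modularityScore G A

/-- The modularity is the largest score. -/
theorem isGreatest_modularity (G : SimpleGraph V) :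
    IsGreatest (Set.range (modularityScore G)) (modularity G) := by
  refine ⟨?_, ?_⟩
  · obtain ⟨A, hA⟩ := exists_eq_ciSup_of_finite (f := modularityScore G)
    exact ⟨A, hA⟩
  · rintro _ ⟨A, rfl⟩
    exact le_ciSup (Set.finite_range (modularityScore G)).bddAbove A

/-- The modularity deficit `δ_A(G) = q^*(G) - q_A(G)`. -/
noncomputable def deficit (G : SimpleGraph V)
    (A : Finpartition (Finset.univ : Finset V)) : ℝ :=
  modularity G - modularityScore G A

open scoped Classical in
/-- The partition of the vertex set into the sets of vertices with equal label. -/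
noncomputable def labelPartition {α : Type*} (f : V → α) :
    Finpartition (Finset.univ : Finset V) :=
  Finpartition.ofSetoid (Setoid.ker f)

theorem mem_part_labelPartition {α : Type*} (f : V → α) (u v : V) :
    v ∈ (labelPartition f).part u ↔ f u = f v := by
  classical
  unfold labelPartition
  rw [Finpartition.mem_part_ofSetoid_iff_rel, Setoid.ker_def]

end Modularity

/-! ### The random subgraph -/

/-- The law of `G_p`: each edge of `G` is kept independently with probability `p`, and the vertex set
does not change. -/
noncomputable def randomSubgraph {V : Type*} (G : SimpleGraph V) (p : unitInterval) :
    MeasureTheory.Measure (SimpleGraph V) :=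
  (ProbabilityTheory.setBernoulli G.edgeSet p).map SimpleGraph.fromEdgeSet

/-! ### A random access machine with a count of operations -/

/-- The state of the machine: registers and a memory that is addressed by the contents of
registers. -/
structure RamState where
  reg : ℕ → ℕ
  mem : ℕ → ℕ

/-- Programs of a random access machine, with addition and truncated subtraction as arithmetic. A
program mentions finitely many registers, by fixed names; the memory is accessed indirectly. -/
inductive RamProgram where
  /-- do nothing -/
  | skip
  /-- `reg a := k` -/
  | const (a k : ℕ)
  /-- `reg a := reg b + reg c` -/
  | add (a b c : ℕ)
  /-- `reg a := reg b - reg c`, and `0` if this is negative -/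
  | sub (a b c : ℕ)
  /-- `reg a := mem (reg b)` -/
  | load (a b : ℕ)
  /-- `mem (reg a) := reg b` -/
  | store (a b : ℕ)
  /-- first `P`, then `Q` -/
  | seq (P Q : RamProgram)
  /-- if `reg a < reg b` then `P` else `Q` -/
  | ifLt (a b : ℕ) (P Q : RamProgram)
  /-- while `reg a < reg b` do `P` -/
  | whileLt (a b : ℕ) (P : RamProgram)

/-- `Exec P s t s'`: started in the state `s`, the program `P` halts in the state `s'` after exactly
`t` operations. Every instruction and every evaluation of a test counts as one operation. -/
inductive Exec : RamProgram → RamState → ℕ → RamState → Prop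
  | skip (s : RamState) : Exec .skip s 1 s
  | const (s : RamState) (a k : ℕ) :
      Exec (.const a k) s 1 ⟨Function.update s.reg a k, s.mem⟩
  | add (s : RamState) (a b c : ℕ) :
      Exec (.add a b c) s 1 ⟨Function.update s.reg a (s.reg b + s.reg c), s.mem⟩
  | sub (s : RamState) (a b c : ℕ) :
      Exec (.sub a b c) s 1 ⟨Function.update s.reg a (s.reg b - s.reg c), s.mem⟩
  | load (s : RamState) (a b : ℕ) :
      Exec (.load a b) s 1 ⟨Function.update s.reg a (s.mem (s.reg b)), s.mem⟩
  | store (s : RamState) (a b : ℕ) :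
      Exec (.store a b) s 1 ⟨s.reg, Function.update s.mem (s.reg a) (s.reg b)⟩
  | seq {P Q : RamProgram} {s s₁ s₂ : RamState} {t₁ t₂ : ℕ} :
      Exec P s t₁ s₁ → Exec Q s₁ t₂ s₂ → Exec (.seq P Q) s (t₁ + t₂) s₂
  | ifTrue {P Q : RamProgram} {s s₁ : RamState} {t a b : ℕ} :
      s.reg a < s.reg b → Exec P s t s₁ → Exec (.ifLt a b P Q) s (1 + t) s₁
  | ifFalse {P Q : RamProgram} {s s₁ : RamState} {t a b : ℕ} :
      ¬ s.reg a < s.reg b → Exec Q s t s₁ → Exec (.ifLt a b P Q) s (1 + t) s₁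
  | whileDone {P : RamProgram} {s : RamState} {a b : ℕ} :
      ¬ s.reg a < s.reg b → Exec (.whileLt a b P) s 1 s
  | whileStep {P : RamProgram} {s s₁ s₂ : RamState} {t₁ t₂ a b : ℕ} :
      s.reg a < s.reg b → Exec P s t₁ s₁ → Exec (.whileLt a b P) s₁ t₂ s₂ →
        Exec (.whileLt a b P) s (1 + t₁ + t₂) s₂

/-- The machine is deterministic. -/
theorem Exec.deterministic {P : RamProgram} {s s₁ s₂ : RamState} {t₁ t₂ : ℕ}
    (h₁ : Exec P s t₁ s₁) (h₂ : Exec P s t₂ s₂) : t₁ = t₂ ∧ s₁ = s₂ := by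
  induction h₁ generalizing t₂ s₂ with
  | skip | const | add | sub | load | store => cases h₂; exact ⟨rfl, rfl⟩
  | seq _ _ ih₁ ih₂ =>
    cases h₂ with
    | seq k₁ k₂ =>
      obtain ⟨rfl, rfl⟩ := ih₁ k₁
      obtain ⟨rfl, rfl⟩ := ih₂ k₂
      exact ⟨rfl, rfl⟩
  | ifTrue h _ ih =>
    cases h₂ with
    | ifTrue _ k => obtain ⟨rfl, rfl⟩ := ih k; exact ⟨rfl, rfl⟩
    | ifFalse h' _ => exact absurd h h'
  | ifFalse h _ ih =>
    cases h₂ with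
    | ifTrue h' _ => exact absurd h' h
    | ifFalse _ k => obtain ⟨rfl, rfl⟩ := ih k; exact ⟨rfl, rfl⟩
  | whileDone h =>
    cases h₂ with
    | whileDone => exact ⟨rfl, rfl⟩
    | whileStep h' _ _ => exact absurd h' h
  | whileStep h _ _ ih₁ ih₂ =>
    cases h₂ with
    | whileDone h' => exact absurd h h'
    | whileStep _ k₁ k₂ =>
      obtain ⟨rfl, rfl⟩ := ih₁ k₁
      obtain ⟨rfl, rfl⟩ := ih₂ k₂
      exact ⟨rfl, rfl⟩

/-- The state in which all registers are `0` and the memory holds the given list, followed by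
zeros. -/
def initialState (l : List ℕ) : RamState := ⟨fun _ => 0, fun i => l.getD i 0⟩

/-! ### Linear-time computation of a partition from a graph and a partition -/

/-- `L` lists each edge of `H` exactly once, in any order, and each with its two ends in any
order. -/
def IsEdgeList {n : ℕ} (H : SimpleGraph (Fin n)) (L : List (Fin n × Fin n)) : Prop :=
  (L.map fun e => s(e.1, e.2)).Nodup ∧
    ∀ e : Sym2 (Fin n), e ∈ L.map (fun e => s(e.1, e.2)) ↔ e ∈ H.edgeSet

/-- The input: the numbers of vertices and of edges, the labels of the vertices `0, …, n - 1`, the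
ends of the edges. -/
def inputList (n : ℕ) (L : List (Fin n × Fin n)) (l : Fin n → Fin n) : List ℕ :=
  n :: L.length ::
    (List.ofFn (fun v => (l v : ℕ)) ++ L.flatMap fun e => [(e.1 : ℕ), (e.2 : ℕ)])

/-- `F` maps a graph on `{0, …, n - 1}`, given by a list of its edges, and a labelling of its
vertices, to a new labelling. Such a map is computed in linear time if some program replaces, for
every graph and labelling, the old labels by the new ones (in the same memory cells), with a number
of operations which is at most a constant times the number of vertices plus the number of edges (plus
one, for the graph without vertices). -/
def LinearTime (F : (n : ℕ) → List (Fin n × Fin n) → (Fin n → Fin n) → Fin n → ℕ) : Prop :=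
  ∃ (P : RamProgram) (K : ℕ),
    ∀ (n : ℕ) (H : SimpleGraph (Fin n)) (L : List (Fin n × Fin n)), IsEdgeList H L →
      ∀ l : Fin n → Fin n, ∃ (t : ℕ) (s : RamState),
        Exec P (initialState (inputList n L l)) t s ∧
          t ≤ K * (n + L.length + 1) ∧ ∀ v : Fin n, s.mem (2 + v) = F n L l v

/-- Every graph has an edge list. -/
theorem exists_isEdgeList {n : ℕ} (H : SimpleGraph (Fin n)) : ∃ L, IsEdgeList H L := by
  classical
  have hq : ∀ e : Sym2 (Fin n), s((Quot.out e).1, (Quot.out e).2) = e := fun e => Quot.out_eq e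
  refine ⟨H.edgeFinset.toList.map Quot.out, ?_⟩
  have h : (H.edgeFinset.toList.map Quot.out).map (fun e : Fin n × Fin n => s(e.1, e.2)) =
      H.edgeFinset.toList := by
    rw [List.map_map]
    refine (List.map_congr_left fun e _ => ?_).trans (List.map_id _)
    exact hq e
  refine ⟨?_, fun e => ?_⟩
  · rw [h]; exact Finset.nodup_toList _
  · rw [h]; simp

/-- Every partition of `{0, …, n - 1}` is given by a labelling with labels in `{0, …, n - 1}`. -/
theorem exists_labelPartition_eq {n : ℕ} (A : Finpartition (Finset.univ : Finset (Fin n))) :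
    ∃ l : Fin n → Fin n, labelPartition l = A := by
  classical
  have hne : ∀ v, (A.part v).Nonempty := fun v => ⟨v, A.mem_part (Finset.mem_univ v)⟩
  have key : ∀ u v, (A.part u).min' (hne u) = (A.part v).min' (hne v) ↔ A.part u = A.part v := by
    intro u v
    refine ⟨fun h => ?_, fun h => by simp only [h]⟩
    refine A.eq_of_mem_parts (A.part_mem.2 (Finset.mem_univ _)) (A.part_mem.2 (Finset.mem_univ _))
      (Finset.min'_mem _ (hne u)) ?_
    rw [h]; exact Finset.min'_mem _ _
  refine ⟨fun v => (A.part v).min' (hne v), ?_⟩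
  have hpart : ∀ u, (labelPartition fun v => (A.part v).min' (hne v)).part u = A.part u := by
    intro u
    ext v
    rw [mem_part_labelPartition, key]
    constructor
    · intro h; rw [h]; exact A.mem_part (Finset.mem_univ v)
    · intro h
      exact A.eq_of_mem_parts (A.part_mem.2 (Finset.mem_univ _))
        (A.part_mem.2 (Finset.mem_univ _)) h (A.mem_part (Finset.mem_univ v))
  have hparts : ∀ B : Finpartition (Finset.univ : Finset (Fin n)), ∀ S,
      S ∈ B.parts ↔ ∃ u, B.part u = S := by
    intro B S
    constructor
    · intro hS
      obtain ⟨u, hu⟩ := B.nonempty_of_mem_parts hS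
      exact ⟨u, B.part_eq_of_mem hS hu⟩
    · rintro ⟨u, rfl⟩; exact B.part_mem.2 (Finset.mem_univ u)
  ext S
  rw [hparts, hparts]
  simp only [hpart]

end SampledModularity

/-!
Two facts carry the proof: a graph has nearly optimal partitions with a bounded number of parts, and
a random subgraph preserves the scores of all partitions with a bounded number of parts.

**Few parts.** Line up the parts of a partition of `H`, with `m` edges, by their labels, and cut the
line into bins: a part goes to the bin `⌈K x / 2m⌉` if the parts before it have total volume `x`.
There are at most `K + 1` bins. The number of edges inside parts does not drop, and within a bin all
parts but the last one have volume at most `2m / K` in total, so that a vertex meets new earlier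
classmates of volume at most `2m / K`. Hence the degree tax grows by at most `2 / K`
(`IsEdgeList.modularityScore_sub_le`). This merging is the algorithm: one pass over the ends of the
edges finds the volumes of the parts, one pass over the labels finds the bins, and one pass over the
vertices replaces the labels. Volumes are counted in units of `K`, and a bin has a number at most
`K`, so that additions and a bounded loop replace the multiplication and the division
(`linearTime_mergeLabel`).

**Concentration.** For each partial labelling of the vertices, the edges inside its classes form a
fixed set of at most `m = e(G)` edges, of which `G_p` keeps a number within `η m p` of the mean, up to
a probability of at most `2 exp (-η² m p / 4)`, by Chernoff's inequality
(`setBernoulli_real_abs_sub_le`). There are `(K + 2) ^ n` partial labellings with `K + 1` labels. For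
`K ≈ 8 / ε` and `η = ε / 32` a union bound succeeds once `m p / n` exceeds a multiple of
`ε⁻² (1 + log ε⁻¹)`, in particular above the threshold of order `ε⁻³ log ε⁻¹` that is chosen here
(`le_randomSubgraph_real`, `union_bound_le`). The volume of a class is determined by the numbers of
edges in the graph, inside the class, and inside its complement. The relative volumes `xᵢ` in `G_p`
and `yᵢ` in `G` sum to `1`, so that `|∑ xᵢ² - ∑ yᵢ²| ≤ 2 max |xᵢ - yᵢ|` for the degree taxes; all
scores of labellings with `K + 1` labels therefore differ by at most `7η`
(`abs_modularityScore_sub_le`).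

Both claims of the theorem follow by passing between `G` and `G_p` along merged partitions.
-/

namespace SampledModularity

/-! ### Verified execution with a time bound -/

/-- Started in `s`, the program `P` halts within `c` operations in a state that satisfies `Q`. -/
def HaltsIn (P : RamProgram) (s : RamState) (c : ℕ) (Q : RamState → Prop) : Prop :=
  ∃ (t : ℕ) (s' : RamState), Exec P s t s' ∧ t ≤ c ∧ Q s'

namespace HaltsIn

variable {P R : RamProgram} {s s₁ : RamState} {c d : ℕ} {Q Q' : RamState → Prop}

theorem last (h : Exec P s 1 s₁) (hQ : Q s₁) : HaltsIn P s 1 Q :=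
  ⟨1, s₁, h, le_rfl, hQ⟩

theorem seq (h : HaltsIn P s c fun s₁ => HaltsIn R s₁ d Q) :
    HaltsIn (.seq P R) s (c + d) Q := by
  obtain ⟨t, s₁, h₁, ht, t', s₂, h₂, ht', hQ⟩ := h
  exact ⟨t + t', s₂, h₁.seq h₂, by omega, hQ⟩

theorem step (h : Exec P s 1 s₁) (h' : HaltsIn R s₁ c Q) : HaltsIn (.seq P R) s (c + 1) Q := by
  rw [add_comm]
  exact seq (last h h')

theorem mono (h : HaltsIn P s c Q) (hc : c ≤ d) (hQ : ∀ s, Q s → Q' s) : HaltsIn P s d Q' := by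
  obtain ⟨t, s', h, ht, hs⟩ := h
  exact ⟨t, s', h, ht.trans hc, hQ s' hs⟩

/-- A loop halts after exactly `N` rounds if it preserves an invariant `I` that is indexed by the
number of rounds done and that determines the value of the test. -/
theorem whileLt {a b N : ℕ} (I : ℕ → RamState → Prop)
    (hlt : ∀ i < N, ∀ s, I i s → s.reg a < s.reg b)
    (hbody : ∀ i < N, ∀ s, I i s → HaltsIn P s c (I (i + 1)))
    (hdone : ∀ s, I N s → ¬ s.reg a < s.reg b) (hs : I 0 s) :
    HaltsIn (.whileLt a b P) s (N * (c + 1) + 1) (I N) := by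
  suffices H : ∀ k i s, i + k = N → I i s →
      HaltsIn (.whileLt a b P) s (k * (c + 1) + 1) (I N) from H N 0 s (by simp) hs
  intro k
  induction k with
  | zero =>
    rintro i s rfl h
    exact ⟨1, s, .whileDone (hdone s h), by simp, h⟩
  | succ k ih =>
    intro i s hi h
    obtain ⟨t₁, s₁, h₁, ht₁, hI⟩ := hbody i (by omega) s h
    obtain ⟨t₂, s₂, h₂, ht₂, hI₂⟩ := ih (i + 1) s₁ (by omega) hI
    refine ⟨_, s₂, .whileStep (hlt i (by omega) s h) h₁ h₂, ?_, hI₂⟩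
    rw [Nat.succ_mul]
    omega

end HaltsIn

/-! ### The program that merges parts -/

/-- Read each end of an edge, look up its label, and add `K` (register 7) to the counter of that
label. The counters are the cells that follow the input; register 6 holds the address of the first
one. -/
def countLoop : RamProgram :=
  .whileLt 5 6 <|
    .seq (.load 8 5) <| .seq (.add 8 2 8) <| .seq (.load 8 8) <| .seq (.add 8 6 8) <|
    .seq (.load 9 8) <| .seq (.add 9 9 7) <| .seq (.store 8 9) <| .add 5 5 1

/-- Replace the counter of each label by its bin: register 11 holds the sum `x` of the counters seen
so far, and register 12 counts how often register 4 has to be added up to reach `x`. -/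
def binLoop : RamProgram :=
  .whileLt 10 3 <|
    .seq (.add 8 6 10) <| .seq (.load 9 8) <| .seq (.const 12 0) <| .seq (.const 13 0) <|
    .seq (.whileLt 13 11 <| .seq (.add 13 13 4) (.add 12 12 1)) <|
    .seq (.store 8 12) <| .seq (.add 11 11 9) (.add 10 10 1)

/-- Replace each label by its bin. -/
def relabelLoop : RamProgram :=
  .whileLt 14 3 <|
    .seq (.add 8 2 14) <| .seq (.load 9 8) <| .seq (.add 9 6 9) <| .seq (.load 9 9) <|
    .seq (.store 8 9) <| .add 14 14 1

/-- Read the numbers of vertices and edges, then run the three loops. -/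
def mergeProgram (K : ℕ) : RamProgram :=
  .seq (.const 1 1) <| .seq (.const 2 2) <| .seq (.load 3 0) <| .seq (.load 4 1) <|
  .seq (.add 4 4 4) <| .seq (.add 5 2 3) <| .seq (.add 6 5 4) <| .seq (.const 7 K) <|
  .seq countLoop <| .seq binLoop relabelLoop

/-- The registers that keep their values during the three loops. -/
structure Frame (n M K : ℕ) (s : RamState) : Prop where
  one : s.reg 1 = 1
  two : s.reg 2 = 2
  numVertices : s.reg 3 = n
  numEnds : s.reg 4 = M
  base : s.reg 6 = 2 + n + M
  scale : s.reg 7 = K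

/-- After the first loop, the counter of the label `j` is `K` times the volume of its class. -/
theorem countLoop_halts {n M K : ℕ} {m₀ : ℕ → ℕ} {s : RamState} (hf : Frame n M K s)
    (hend : ∀ i < M, m₀ (2 + n + i) < n) (h5 : s.reg 5 = 2 + n)
    (h10 : s.reg 10 = 0) (h11 : s.reg 11 = 0) (h14 : s.reg 14 = 0) (hmem : s.mem = m₀)
    (hzero : ∀ j, m₀ (2 + n + M + j) = 0) :
    HaltsIn countLoop s (M * 9 + 1) fun s' =>
      Frame n M K s' ∧ s'.reg 10 = 0 ∧ s'.reg 11 = 0 ∧ s'.reg 14 = 0 ∧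
      (∀ a < 2 + n + M, s'.mem a = m₀ a) ∧
      ∀ j, s'.mem (2 + n + M + j) = K * Nat.count (fun i => m₀ (2 + m₀ (2 + n + i)) = j) M := by
  refine (HaltsIn.whileLt (N := M) (c := 8) (fun i s' => s'.reg 5 = 2 + n + i ∧
    Frame n M K s' ∧ s'.reg 10 = 0 ∧ s'.reg 11 = 0 ∧ s'.reg 14 = 0 ∧
      (∀ a < 2 + n + M, s'.mem a = m₀ a) ∧
      ∀ j, s'.mem (2 + n + M + j) = K * Nat.count (fun i => m₀ (2 + m₀ (2 + n + i)) = j) i)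
    ?_ ?_ ?_ ?_).mono le_rfl fun s' h => h.2
  · rintro i hi s' ⟨h5, hf, -⟩
    rw [h5, hf.base]; omega
  · rintro i hi ⟨r, m⟩ ⟨h5, ⟨f1, f2, f3, f4, f6, f7⟩, h10, h11, h14, hm, hc⟩
    simp only at *
    have hi' := hend i hi
    have e1 : m (2 + n + i) = m₀ (2 + n + i) := hm _ (by omega)
    have e2 : m (2 + m₀ (2 + n + i)) = m₀ (2 + m₀ (2 + n + i)) := hm _ (by omega)
    refine .step (.load _ _ _) <| .step (.add _ _ _ _) <| .step (.load _ _ _) <|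
      .step (.add _ _ _ _) <| .step (.load _ _ _) <| .step (.add _ _ _ _) <|
      .step (.store _ _ _) <| .last (.add _ _ _ _) ?_
    refine ⟨?_, ⟨?_, ?_, ?_, ?_, ?_, ?_⟩, ?_, ?_, ?_, ?_, ?_⟩
    all_goals simp [Function.update_apply, *]
    · omega
    · intro a ha
      rw [if_neg (by omega)]; exact hm a ha
    · intro j
      rw [Nat.count_succ]
      split_ifs with h h' h'
      · subst h; ring
      · exact absurd h.symm h'
      · exact absurd h'.symm h
      · simp
  · rintro s' ⟨h5, hf, -⟩
    rw [h5, hf.base]; omega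
  · subst hmem
    exact ⟨by simpa using h5, hf, h10, h11, h14, fun _ _ => rfl, by simpa using hzero⟩

/-- The quotient `x / M`, rounded up (and `0` if `M = 0`). -/
def ceilQuot (x M : ℕ) : ℕ := (x + M - 1) / M

theorem lt_ceilQuot_iff {x M i : ℕ} (hM : 0 < M) : i < ceilQuot x M ↔ i * M < x := by
  rw [ceilQuot, ← Nat.succ_le_iff, Nat.le_div_iff_mul_le hM, Nat.succ_mul]
  omega

theorem ceilQuot_le {x M K : ℕ} (h : x ≤ K * M) : ceilQuot x M ≤ K := by
  rcases Nat.eq_zero_or_pos M with rfl | hM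
  · simp [ceilQuot]
  · rw [← not_lt, lt_ceilQuot_iff hM]; omega

/-- The second loop replaces the counter of `j`, which is `K * vol j`, by the rounded quotient of
`K * (vol 0 + ⋯ + vol (j - 1))` and the total volume. -/
theorem binLoop_halts {n M K : ℕ} {m₀ vol : ℕ → ℕ} {s : RamState} (hf : Frame n M K s)
    (hvol : ∀ j ≤ n, ∑ i ∈ Finset.range j, vol i ≤ M)
    (h10 : s.reg 10 = 0) (h11 : s.reg 11 = 0) (h14 : s.reg 14 = 0)
    (hmem : ∀ a < 2 + n + M, s.mem a = m₀ a) (hcnt : ∀ j, s.mem (2 + n + M + j) = K * vol j) :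
    HaltsIn binLoop s (n * (K * 3 + 9) + 1) fun s' =>
      Frame n M K s' ∧ s'.reg 14 = 0 ∧ (∀ a < 2 + n + M, s'.mem a = m₀ a) ∧
      ∀ j < n, s'.mem (2 + n + M + j) = ceilQuot (K * ∑ i ∈ Finset.range j, vol i) M := by
  refine (HaltsIn.whileLt (N := n) (c := 4 + ((K * 3 + 1) + 3)) (fun j s' => s'.reg 10 = j ∧
    s'.reg 11 = K * ∑ i ∈ Finset.range j, vol i ∧
    Frame n M K s' ∧ s'.reg 14 = 0 ∧ (∀ a < 2 + n + M, s'.mem a = m₀ a) ∧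
      ∀ j', s'.mem (2 + n + M + j') =
        if j' < j then ceilQuot (K * ∑ i ∈ Finset.range j', vol i) M else K * vol j')
    ?_ ?_ ?_ ?_).mono (by ring_nf; rfl) ?_
  · rintro j hj s' ⟨h10, -, hf, -⟩
    rwa [h10, hf.numVertices]
  · rintro j hj ⟨r, m⟩ ⟨h10, h11, ⟨f1, f2, f3, f4, f6, f7⟩, h14, hm, hc⟩
    simp only at *
    rw [show 4 + ((K * 3 + 1) + 3) = ((K * 3 + 1) + 3) + 1 + 1 + 1 + 1 by ring]
    refine .step (.add _ _ _ _) <| .step (.load _ _ _) <| .step (.const _ _ _) <|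
      .step (.const _ _ _) <| .seq (c := K * 3 + 1) (d := 3) ?_
    set x := K * ∑ i ∈ Finset.range j, vol i with hx
    -- The inner loop does `⌈x / M⌉ ≤ K` rounds, which makes the cost of a round of the outer loop
    -- a constant.
    have hxM : x ≤ K * M := Nat.mul_le_mul_left K (hvol j hj.le)
    refine (HaltsIn.whileLt (N := ceilQuot x M) (c := 2) (fun i s' => s'.reg 12 = i ∧
      s'.reg 13 = i * M ∧ s'.reg 8 = 2 + n + M + j ∧ s'.reg 9 = K * vol j ∧
      s'.reg 10 = j ∧ s'.reg 11 = x ∧ Frame n M K s' ∧ s'.reg 14 = 0 ∧ s'.mem = m)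
      ?_ ?_ ?_ ?_).mono (d := K * 3 + 1) (by have := ceilQuot_le hxM; omega) ?_
    · rintro i hi s' ⟨-, h13, -, -, -, h11, -⟩
      rw [h13, h11]
      rcases Nat.eq_zero_or_pos M with rfl | hM
      · simp [ceilQuot] at hi
      · exact (lt_ceilQuot_iff hM).1 hi
    · rintro i hi ⟨r', m'⟩ ⟨h12, h13, h8, h9, h10, h11, ⟨f1, f2, f3, f4, f6, f7⟩, h14, hm⟩
      simp only at *
      refine .step (.add _ _ _ _) <| .last (.add _ _ _ _) ?_
      refine ⟨?_, ?_, ?_, ?_, ?_, ?_, ⟨?_, ?_, ?_, ?_, ?_, ?_⟩, ?_, ?_⟩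
      all_goals simp [*]
      ring
    · rintro s' ⟨-, h13, -, -, -, h11, -⟩
      rw [h13, h11]
      rcases Nat.eq_zero_or_pos M with rfl | hM
      · simp only [mul_zero, Nat.le_zero] at hxM
        simp [hxM]
      · rw [← lt_ceilQuot_iff hM]; exact lt_irrefl _
    · refine ⟨?_, ?_, ?_, ?_, ?_, ?_, ⟨?_, ?_, ?_, ?_, ?_, ?_⟩, ?_, ?_⟩
      all_goals simp [*]
    · rintro ⟨r', m'⟩ ⟨h12, h13, h8, h9, h10, h11, ⟨f1, f2, f3, f4, f6, f7⟩, h14, rfl⟩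
      simp only at *
      refine .step (.store _ _ _) <| .step (.add _ _ _ _) <| .last (.add _ _ _ _) ?_
      refine ⟨?_, ?_, ⟨?_, ?_, ?_, ?_, ?_, ?_⟩, ?_, ?_, ?_⟩
      · simp [h10, f1]
      · simp [h11, h9, Finset.sum_range_succ, hx, mul_add]
      · simp [*]
      · simp [*]
      · simp [*]
      · simp [*]
      · simp [*]
      · simp [*]
      · simp [*]
      · intro a ha
        simp only [Function.update_apply, h8]
        rw [if_neg (by omega)]; exact hm a ha
      · intro j'
        simp only [Function.update_apply, h8]
        split_ifs with h h' h'
        · obtain rfl : j' = j := by omega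
          exact h12
        · omega
        · rw [hc, if_pos (by omega)]
        · rw [hc, if_neg (by omega)]
  · rintro s' ⟨h10, -, hf, -⟩
    rw [h10, hf.numVertices]; exact lt_irrefl _
  · exact ⟨h10, by simpa using h11, hf, h14, hmem, by simpa using hcnt⟩
  · rintro s' ⟨-, -, hf, h14, hm, hc⟩
    exact ⟨hf, h14, hm, fun j hj => by rw [hc, if_pos hj]⟩

theorem relabelLoop_halts {n M K : ℕ} {m₀ q : ℕ → ℕ} {s : RamState} (hf : Frame n M K s)
    (hlab : ∀ v < n, m₀ (2 + v) < n) (h14 : s.reg 14 = 0)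
    (hmem : ∀ a < 2 + n + M, s.mem a = m₀ a) (hq : ∀ j < n, s.mem (2 + n + M + j) = q j) :
    HaltsIn relabelLoop s (n * 7 + 1) fun s' => ∀ v < n, s'.mem (2 + v) = q (m₀ (2 + v)) := by
  refine (HaltsIn.whileLt (N := n) (c := 6) (fun v s' => s'.reg 14 = v ∧
    Frame n M K s' ∧ (∀ j < n, s'.mem (2 + n + M + j) = q j) ∧
      ∀ w < n, s'.mem (2 + w) = if w < v then q (m₀ (2 + w)) else m₀ (2 + w))
    ?_ ?_ ?_ ?_).mono le_rfl ?_
  · rintro i hi s' ⟨h, hf, -⟩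
    rwa [h, hf.numVertices]
  · rintro v hv ⟨r, m⟩ ⟨h14, ⟨f1, f2, f3, f4, f6, f7⟩, hq, hm⟩
    simp only at *
    have e1 : m (2 + v) = m₀ (2 + v) := by rw [hm v hv, if_neg (lt_irrefl _)]
    have e2 := hq _ (hlab v hv)
    refine .step (.add _ _ _ _) <| .step (.load _ _ _) <| .step (.add _ _ _ _) <|
      .step (.load _ _ _) <| .step (.store _ _ _) <| .last (.add _ _ _ _) ?_
    refine ⟨?_, ⟨?_, ?_, ?_, ?_, ?_, ?_⟩, ?_, ?_⟩
    · simp [*]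
    · simp [*]
    · simp [*]
    · simp [*]
    · simp [*]
    · simp [*]
    · simp [*]
    · intro j hj
      simp only [Function.update_apply, f2, h14]
      simp [show 2 + n + M + j ≠ 2 + v by omega, hq j hj]
    · intro w hw
      by_cases h : w = v
      · subst h
        simp [f2, h14, f6, e1, e2]
      · have hw' : w < v + 1 ↔ w < v := by omega
        simp [f2, h14, h, hm w hw, hw']
  · rintro s' ⟨h, hf, -⟩
    rw [h, hf.numVertices]; exact lt_irrefl _
  · refine ⟨h14, hf, hq, fun w hw => ?_⟩
    rw [if_neg (Nat.not_lt_zero _)]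
    exact hmem _ (by omega)
  · rintro s' ⟨-, -, -, h⟩ v hv
    rw [h v hv, if_pos hv]

/-- Stated for the contents `m₀` of the memory: `n` labels from address `2` on, then `2 * m` ends of
edges. The bin of a label is the number of ends with a smaller label, scaled and rounded. -/
theorem mergeProgram_halts {n m K : ℕ} {m₀ : ℕ → ℕ} (hn : m₀ 0 = n) (hm : m₀ 1 = m)
    (hlab : ∀ v < n, m₀ (2 + v) < n) (hend : ∀ i < 2 * m, m₀ (2 + n + i) < n)
    (hzero : ∀ j, m₀ (2 + n + 2 * m + j) = 0) :
    HaltsIn (mergeProgram K) ⟨fun _ => 0, m₀⟩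
      ((2 * m * 9 + 1 + (n * (K * 3 + 9) + 1 + (n * 7 + 1))) + 8) fun s =>
      ∀ v < n, s.mem (2 + v) =
        ceilQuot (K * Nat.count (fun i => m₀ (2 + m₀ (2 + n + i)) < m₀ (2 + v)) (2 * m))
          (2 * m) := by
  have hsum : ∀ j, ∑ i ∈ Finset.range j, Nat.count (fun k => m₀ (2 + m₀ (2 + n + k)) = i) (2 * m) =
      Nat.count (fun k => m₀ (2 + m₀ (2 + n + k)) < j) (2 * m) := by
    intro j
    generalize 2 * m = M
    induction M with
    | zero => simp
    | succ M ih => simp only [Nat.count_succ, Finset.sum_add_distrib, ih]; simp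
  refine .step (.const _ _ _) <| .step (.const _ _ _) <| .step (.load _ _ _) <|
    .step (.load _ _ _) <| .step (.add _ _ _ _) <| .step (.add _ _ _ _) <|
    .step (.add _ _ _ _) <| .step (.const _ _ _) <| .seq ?_
  refine (countLoop_halts (n := n) (M := 2 * m) (K := K) (m₀ := m₀) ⟨?_, ?_, ?_, ?_, ?_, ?_⟩ hend
    ?_ ?_ ?_ ?_ ?_ hzero).mono le_rfl ?_
  on_goal 12 =>
    rintro s ⟨hf, h10, h11, h14, hmem, hcnt⟩
    refine .seq ((binLoop_halts hf (fun j _ => ?_) h10 h11 h14 hmem hcnt).mono le_rfl ?_)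
    · rw [hsum]
      exact Nat.count_le _
    · rintro s ⟨hf, h14, hmem, hq⟩
      refine (relabelLoop_halts hf hlab h14 hmem hq).mono le_rfl fun s hs v hv => ?_
      rw [hs v hv, hsum]
  all_goals simp [hn, hm, two_mul]

/-! ### Merging parts takes linear time -/

/-- The ends of the listed edges: every vertex occurs as often as its degree says, so that volumes are
counts in this list. -/
def ends {n : ℕ} (L : List (Fin n × Fin n)) : List (Fin n) :=
  L.flatMap fun e => [e.1, e.2]

theorem length_ends {n : ℕ} (L : List (Fin n × Fin n)) : (ends L).length = 2 * L.length := by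
  simp [ends, List.length_flatMap, mul_comm]

/-- The output of the algorithm: the parts with labels `0, 1, …` are lined up, and a part goes to bin
`⌈K * x / (2 * m)⌉` if the parts before it have volume `x` in total. -/
def mergeLabel (K n : ℕ) (L : List (Fin n × Fin n)) (l : Fin n → Fin n) (v : Fin n) : ℕ :=
  ceilQuot (K * (ends L).countP fun u => l u < l v) (2 * L.length)

theorem count_getD_eq_countP (E : List ℕ) (p : ℕ → Prop) [DecidablePred p] (d : ℕ) :
    Nat.count (fun i => p (E.getD i d)) E.length = E.countP p := by
  induction E with
  | nil => simp
  | cons a E ih => simpa [Nat.count_succ', List.countP_cons, List.getD_eq_getElem?_getD] using ih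

theorem linearTime_mergeLabel (K : ℕ) : LinearTime (mergeLabel K) := by
  refine ⟨mergeProgram K, 3 * K + 30, fun n H L _ l => ?_⟩
  set m₀ : ℕ → ℕ := fun i => (inputList n L l).getD i 0 with hm₀
  have hE : (L.flatMap fun e => [(e.1 : ℕ), (e.2 : ℕ)]) = (ends L).map Fin.val := by
    simp [ends, List.map_flatMap]
  have hlen : ((ends L).map Fin.val).length = 2 * L.length := by simp [length_ends]
  have hlab : ∀ v : Fin n, m₀ (2 + v) = l v := by
    intro v
    rw [hm₀, add_comm]
    simp [inputList, List.getD_eq_getElem?_getD, List.getElem?_append_left]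
  have hend : ∀ i, m₀ (2 + n + i) = ((ends L).map Fin.val).getD i 0 := by
    intro i
    rw [hm₀, show 2 + n + i = (n + i) + 1 + 1 by ring, ← hE]
    simp [inputList, List.getD_eq_getElem?_getD, List.getElem?_append_right]
  have hendlt : ∀ i < 2 * L.length, ∃ u ∈ ends L, m₀ (2 + n + i) = (u : ℕ) := by
    intro i hi
    have hi' : i < (ends L).length := by rwa [length_ends]
    refine ⟨(ends L)[i], List.getElem_mem _, ?_⟩
    rw [hend]
    simp [List.getD_eq_getElem?_getD, hi']
  obtain ⟨t, s, hs, ht, h⟩ := mergeProgram_halts (n := n) (m := L.length) (K := K) (m₀ := m₀)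
    (by simp [hm₀, inputList]) (by simp [hm₀, inputList])
    (fun v hv => by rw [hlab ⟨v, hv⟩]; exact (l _).2)
    (fun i hi => by obtain ⟨u, -, hu⟩ := hendlt i hi; rw [hu]; exact u.2)
    (fun j => by rw [add_assoc, hend, List.getD_eq_default]; rw [hlen]; omega)
  refine ⟨t, s, hs, ht.trans ?_, fun v => ?_⟩
  · nlinarith
  · rw [h v v.2, mergeLabel, hlab]
    congr 2
    have h1 := count_getD_eq_countP ((ends L).map Fin.val) (fun a => m₀ (2 + a) < l v) 0
    rw [hlen] at h1
    simp only [← hend] at h1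
    rw [h1, List.countP_map]
    refine List.countP_congr fun u _ => ?_
    simp [hlab]

/-! ### The score of a labelling -/

section Score

variable {V : Type*} [Fintype V]

theorem sum_parts_labelPartition [DecidableEq V] {α : Type*} [DecidableEq α] (f : V → α)
    (g : V → V → ℝ) :
    ∑ S ∈ (labelPartition f).parts, ∑ u ∈ S, ∑ v ∈ S, g u v =
      ∑ u, ∑ v, if f u = f v then g u v else 0 := by
  set A := labelPartition f
  have h1 : ∀ S ∈ A.parts, ∑ u ∈ S, ∑ v ∈ S, g u v =
      ∑ u ∈ S, ∑ v, if f u = f v then g u v else 0 := by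
    intro S hS
    refine Finset.sum_congr rfl fun u hu => ?_
    rw [← Finset.sum_filter]
    refine Finset.sum_congr ?_ fun _ _ => rfl
    rw [← A.part_eq_of_mem hS hu]
    ext v
    simp [A, mem_part_labelPartition]
  rw [Finset.sum_congr rfl h1]
  have h2 := A.sup_parts
  rw [Finset.sup_eq_biUnion] at h2
  exact (Finset.sum_biUnion (t := id) A.supIndep.pairwiseDisjoint).symm.trans (by rw [h2])

open scoped Classical in
/-- The number of ordered pairs of adjacent vertices with the same label, where a vertex may also be
left without a label. It is twice the number of edges inside the labelled classes. -/
noncomputable def innerPairs {α : Type*} (G : SimpleGraph V) (g : V → Option α) : ℝ :=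
  ∑ u, ∑ v, if G.Adj u v ∧ g u = g v ∧ g u ≠ none then 1 else 0

open scoped Classical in
theorem degree_eq_sum (G : SimpleGraph V) (u : V) :
    (G.degree u : ℝ) = ∑ v, if G.Adj u v then 1 else 0 := by
  rw [← SimpleGraph.card_neighborFinset_eq_degree, SimpleGraph.neighborFinset_eq_filter]
  simp

open scoped Classical in
theorem sum_degree (G : SimpleGraph V) : ∑ u, (G.degree u : ℝ) = 2 * numEdges G := by
  have := G.sum_degrees_eq_twice_card_edges
  rw [numEdges]
  exact_mod_cast this

open scoped Classical in
theorem sum_adj_mem_edgeSet (G : SimpleGraph V) (T : Set (Sym2 V)) :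
    ∑ u, ∑ v, (if G.Adj u v ∧ s(u, v) ∈ T then (1 : ℝ) else 0) =
      2 * (G.edgeFinset.filter (· ∈ T)).card := by
  set H : SimpleGraph V := SimpleGraph.fromEdgeSet (G.edgeSet ∩ T)
  have hadj : ∀ u v, H.Adj u v ↔ G.Adj u v ∧ s(u, v) ∈ T := by
    intro u v
    simp only [H, SimpleGraph.fromEdgeSet_adj, Set.mem_inter_iff, SimpleGraph.mem_edgeSet]
    exact ⟨fun h => h.1, fun h => ⟨h, h.1.ne⟩⟩
  have hE : numEdges H = (G.edgeFinset.filter (· ∈ T)).card := by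
    rw [numEdges]
    congr 1
    ext e
    induction e with
    | h u v => simp [hadj]
  rw [← hE, ← sum_degree]
  simp only [degree_eq_sum, hadj]

open scoped Classical in
/-- The pairs inside the classes are a fixed set of edges, so that their number is a sum of
independent indicators in a random subgraph. -/
theorem innerPairs_eq_card {α : Type*} (G : SimpleGraph V) (g : V → Option α) :
    innerPairs G g =
      2 * (G.edgeFinset.filter (· ∈ {e | ∃ i, ∀ v ∈ e, g v = some i})).card := by
  rw [← sum_adj_mem_edgeSet, innerPairs]
  refine Finset.sum_congr rfl fun u _ => Finset.sum_congr rfl fun v _ => ?_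
  refine if_congr (and_congr_right fun _ => ?_) rfl rfl
  simp only [Set.mem_ofPred_eq, Sym2.mem_iff, forall_eq_or_imp, forall_eq, ← Option.isSome_iff_ne_none,
    Option.isSome_iff_exists]
  constructor
  · rintro ⟨h, i, hi⟩; exact ⟨i, hi, h ▸ hi⟩
  · rintro ⟨i, hi, hi'⟩; exact ⟨hi.trans hi'.symm, i, hi⟩

theorem innerPairs_nonneg {α : Type*} (G : SimpleGraph V) (g : V → Option α) :
    0 ≤ innerPairs G g :=
  Finset.sum_nonneg fun _ _ => Finset.sum_nonneg fun _ _ => by split_ifs <;> norm_num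

open scoped Classical in
theorem innerPairs_const {α : Type*} (G : SimpleGraph V) (i : α) :
    innerPairs G (fun _ => some i) = 2 * numEdges G := by
  rw [← sum_degree]
  simp [innerPairs, degree_eq_sum]

theorem innerPairs_le {α : Type*} (G : SimpleGraph V) (g : V → Option α) :
    innerPairs G g ≤ 2 * numEdges G := by
  classical
  rw [innerPairs_eq_card, numEdges]
  exact_mod_cast Nat.mul_le_mul_left 2 (Finset.card_filter_le _ _)

open scoped Classical in
/-- The volume of a class is determined by the numbers of edges in the graph, inside the class, and
inside its complement. -/
theorem two_mul_sum_degree_eq {α : Type*} (G : SimpleGraph V) (P : V → Prop) [DecidablePred P]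
    (i : α) :
    2 * ∑ u, (if P u then (G.degree u : ℝ) else 0) =
      2 * numEdges G + innerPairs G (fun u => if P u then some i else none)
        - innerPairs G (fun u => if P u then none else some i) := by
  have h1 : ∑ u, (if P u then (G.degree u : ℝ) else 0) =
      ∑ u, ∑ v, if P u ∧ G.Adj u v then (1 : ℝ) else 0 := by
    refine Finset.sum_congr rfl fun u _ => ?_
    by_cases h : P u <;> simp [h, degree_eq_sum]
  have h2 : ∑ u, (if P u then (G.degree u : ℝ) else 0) =
      ∑ u, ∑ v, if P v ∧ G.Adj u v then (1 : ℝ) else 0 := by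
    rw [h1, Finset.sum_comm]
    simp only [G.adj_comm]
  rw [two_mul]
  nth_rewrite 1 [h1]
  rw [h2, ← sum_degree]
  simp only [degree_eq_sum, innerPairs, ← Finset.sum_add_distrib, ← Finset.sum_sub_distrib]
  refine Finset.sum_congr rfl fun u _ => Finset.sum_congr rfl fun v _ => ?_
  by_cases hu : P u <;> by_cases hv : P v <;> by_cases h : G.Adj u v <;> simp [hu, hv, h]

open scoped Classical in
/-- The degree tax of a labelling, before normalization: the sum of `deg u * deg v` over the ordered
pairs with equal labels. -/
noncomputable def taxSum {α : Type*} (G : SimpleGraph V) (f : V → α) : ℝ :=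
  ∑ u, ∑ v, if f u = f v then (G.degree u : ℝ) * G.degree v else 0

theorem modularityScore_labelPartition [DecidableEq V] {α : Type*} {G : SimpleGraph V}
    (hG : numEdges G ≠ 0) (f : V → α) :
    modularityScore G (labelPartition f) =
      innerPairs G (fun v => some (f v)) / (2 * numEdges G) -
        taxSum G f / (2 * numEdges G) ^ 2 := by
  classical
  have hm : (numEdges G : ℝ) ≠ 0 := by exact_mod_cast hG
  rw [modularityScore, if_neg hG, sum_parts_labelPartition, taxSum, innerPairs]
  simp only [Finset.sum_div, Finset.mul_sum, ← Finset.sum_sub_distrib]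
  refine Finset.sum_congr rfl fun u _ => Finset.sum_congr rfl fun v _ => ?_
  by_cases h : f u = f v <;> by_cases h' : G.Adj u v <;> simp [h, h'] <;> field_simp

end Score

/-! ### Merging parts costs little modularity -/

section Merge

variable {n : ℕ} {H : SimpleGraph (Fin n)} {L : List (Fin n × Fin n)}

theorem IsEdgeList.ne (hL : IsEdgeList H L) {e : Fin n × Fin n} (he : e ∈ L) : e.1 ≠ e.2 := by
  have : s(e.1, e.2) ∈ H.edgeSet := (hL.2 _).1 (List.mem_map_of_mem he)
  exact (H.mem_edgeSet.1 this).ne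

open scoped Classical in
theorem IsEdgeList.toFinset_eq (hL : IsEdgeList H L) :
    (L.map fun e => s(e.1, e.2)).toFinset = H.edgeFinset := by
  ext e
  rw [List.mem_toFinset, hL.2, SimpleGraph.mem_edgeFinset]

theorem IsEdgeList.length_eq (hL : IsEdgeList H L) : L.length = numEdges H := by
  classical
  rw [numEdges, ← hL.toFinset_eq, List.toFinset_card_of_nodup hL.1, List.length_map]

open scoped Classical in
theorem IsEdgeList.count_ends (hL : IsEdgeList H L) (u : Fin n) :
    (ends L).count u = H.degree u := by
  have h1 : (ends L).count u = L.countP fun e => u ∈ s(e.1, e.2) := by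
    have hne : ∀ e ∈ L, e.1 ≠ e.2 := fun e he => hL.ne he
    clear hL
    induction L with
    | nil => simp [ends]
    | cons e L ih =>
      have he := hne e (by simp)
      have ih' := ih fun e he => hne e (List.mem_cons_of_mem _ he)
      rw [ends] at ih' ⊢
      rw [List.flatMap_cons, List.count_append, ih', List.countP_cons, add_comm]
      congr 1
      by_cases ha : u = e.1
      · subst ha
        simp [he.symm]
      · by_cases hb : u = e.2
        · subst hb; simp [he]
        · simp [ha, hb, Ne.symm ha, Ne.symm hb]
  have h2 : (L.countP fun e => u ∈ s(e.1, e.2)) =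
      (L.map fun e => s(e.1, e.2)).countP fun e => u ∈ e := by
    rw [List.countP_map]; rfl
  rw [h1, h2, List.countP_eq_length_filter, ← List.toFinset_card_of_nodup (hL.1.filter _),
    List.toFinset_filter, hL.toFinset_eq, ← SimpleGraph.card_incidenceFinset_eq_degree,
    SimpleGraph.incidenceFinset_eq_filter]
  congr 1
  ext e
  simp

open scoped Classical in
theorem IsEdgeList.countP_ends (hL : IsEdgeList H L) (P : Fin n → Prop) [DecidablePred P] :
    ((ends L).countP fun u => P u) = ∑ u, if P u then H.degree u else 0 := by
  simp only [← hL.count_ends]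
  induction ends L with
  | nil => simp
  | cons a E ih =>
    rw [List.countP_cons, ih]
    simp only [List.count_cons]
    rw [← Finset.sum_filter, ← Finset.sum_filter, Finset.sum_add_distrib]
    simp

theorem ceilQuot_le_iff {x M c : ℕ} (hM : 0 < M) : ceilQuot x M ≤ c ↔ x ≤ c * M := by
  rw [← not_lt, lt_ceilQuot_iff hM, not_lt]

theorem le_add_of_ceilQuot_eq {x y M : ℕ} (hM : 0 < M) (h : ceilQuot x M = ceilQuot y M) :
    y ≤ x + M := by
  have h1 : y ≤ ceilQuot x M * M := (ceilQuot_le_iff hM).1 h.ge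
  rcases Nat.eq_zero_or_pos (ceilQuot x M) with h0 | h0
  · rw [h0] at h1; omega
  · have h2 : (ceilQuot x M - 1) * M < x := (lt_ceilQuot_iff hM).1 (by omega)
    rw [Nat.sub_mul] at h2
    omega

theorem mergeLabel_le (K : ℕ) (l : Fin n → Fin n) (v : Fin n) : mergeLabel K n L l v ≤ K := by
  refine ceilQuot_le (Nat.mul_le_mul_left K ?_)
  rw [← length_ends]
  exact List.countP_le_length

theorem mergeLabel_congr (K : ℕ) {l : Fin n → Fin n} {u v : Fin n} (h : l u = l v) :
    mergeLabel K n L l u = mergeLabel K n L l v := by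
  simp only [mergeLabel, h]

open scoped Classical in
/-- In a bin, all parts but the last one have small total volume. -/
theorem IsEdgeList.mul_sum_degree_le (hL : IsEdgeList H L) (hH : 0 < numEdges H) (K : ℕ)
    (l : Fin n → Fin n) (v : Fin n) :
    K * ∑ u, (if mergeLabel K n L l u = mergeLabel K n L l v ∧ l u < l v then H.degree u else 0) ≤
      2 * numEdges H := by
  set S := Finset.univ.filter fun u => mergeLabel K n L l u = mergeLabel K n L l v ∧ l u < l v
  rcases S.eq_empty_or_nonempty with hS | hS
  · rw [← Finset.sum_filter]
    simp [S] at hS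
    rw [Finset.sum_eq_zero]
    · simp
    · intro u hu
      simp at hu
      exact absurd hu.2 (not_lt.2 (hS hu.1))
  -- The first part of the bin starts within one bin size of the start of the part of `v`.
  obtain ⟨w, hw, hmin⟩ := S.exists_min_image l hS
  obtain ⟨hw1, hw2⟩ := (Finset.mem_filter.1 hw).2
  have h1 := le_add_of_ceilQuot_eq (by rw [hL.length_eq]; omega) hw1
  rw [hL.countP_ends (fun u => l u < l v), hL.countP_ends (fun u => l u < l w), hL.length_eq] at h1
  have h2 : ∑ u, (if l u < l w then H.degree u else 0) +
      ∑ u, (if mergeLabel K n L l u = mergeLabel K n L l v ∧ l u < l v then H.degree u else 0) ≤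
        ∑ u, (if l u < l v then H.degree u else 0) := by
    rw [← Finset.sum_add_distrib]
    refine Finset.sum_le_sum fun u _ => ?_
    by_cases hu : mergeLabel K n L l u = mergeLabel K n L l v ∧ l u < l v
    · have := hmin u (by simp [S, hu])
      rw [if_neg (not_lt.2 this), if_pos hu, if_pos hu.2, zero_add]
    · rw [if_neg hu, add_zero]
      split_ifs with h3 h4
      · exact le_rfl
      · exact absurd (h3.trans hw2) h4
      · exact Nat.zero_le _
      · exact le_rfl
  have h3 := Nat.mul_le_mul_left K h2
  rw [mul_add] at h3
  omega

theorem IsEdgeList.taxSum_mergeLabel_le (hL : IsEdgeList H L) (hH : 0 < numEdges H) {K : ℕ}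
    (hK : 0 < K) (l : Fin n → Fin n) :
    taxSum H (mergeLabel K n L l) ≤ taxSum H l + 2 * (2 * numEdges H) ^ 2 / K := by
  classical
  set q := mergeLabel K n L l with hq
  set D : ℝ := ∑ u, ∑ v, if q u = q v ∧ l u < l v then (H.degree u : ℝ) * H.degree v else 0 with hD
  have hKr : (0 : ℝ) < K := by exact_mod_cast hK
  -- `D` collects the pairs that are new in a bin, with the earlier vertex first; by symmetry the new
  -- pairs contribute `2 * D` to the tax.
  have h1 : D ≤ (2 * numEdges H) ^ 2 / K := by
    rw [hD, Finset.sum_comm, pow_two, ← sum_degree H, Finset.sum_mul, Finset.sum_div]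
    refine Finset.sum_le_sum fun v _ => ?_
    have h : ((K * ∑ u, (if q u = q v ∧ l u < l v then H.degree u else 0) : ℕ) : ℝ) ≤
        ((2 * numEdges H : ℕ) : ℝ) := by exact_mod_cast hL.mul_sum_degree_le hH K l v
    push_cast at h
    rw [sum_degree, le_div_iff₀ hKr]
    calc _ = (H.degree v : ℝ) *
          (K * ∑ u, if q u = q v ∧ l u < l v then (H.degree u : ℝ) else 0) := by
          simp only [Finset.mul_sum, Finset.sum_mul]
          refine Finset.sum_congr rfl fun u _ => ?_
          split_ifs <;> ring
      _ ≤ _ := mul_le_mul_of_nonneg_left h (Nat.cast_nonneg _)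
  have h2 : taxSum H q ≤ taxSum H l + D + D := by
    have hD' : D = ∑ u, ∑ v,
        if q v = q u ∧ l v < l u then (H.degree u : ℝ) * H.degree v else 0 := by
      rw [hD, Finset.sum_comm]
      simp only [mul_comm]
    nth_rewrite 2 [hD']
    rw [hD, taxSum, taxSum]
    simp only [← Finset.sum_add_distrib]
    refine Finset.sum_le_sum fun u _ => Finset.sum_le_sum fun v _ => ?_
    have h0 : (0 : ℝ) ≤ (H.degree u : ℝ) * H.degree v := by positivity
    by_cases h : q u = q v
    · rcases lt_trichotomy (l u) (l v) with h' | h' | h'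
      · simp [h, h', h'.ne, h'.not_gt]
      · simp [h, h']
      · simp [h, h', h'.ne', h'.not_gt]
    · rw [if_neg h]
      split_ifs <;> linarith
  calc taxSum H q ≤ taxSum H l + D + D := h2
    _ ≤ _ := by rw [mul_div_assoc]; linarith

/-- Merging the parts into bins only adds pairs, and raises the degree tax by at most `2 / K`. -/
theorem IsEdgeList.modularityScore_sub_le (hL : IsEdgeList H L) {K : ℕ} (hK : 0 < K)
    (l : Fin n → Fin n) :
    modularityScore H (labelPartition l) - 2 / K ≤
      modularityScore H (labelPartition (mergeLabel K n L l)) := by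
  classical
  rcases Nat.eq_zero_or_pos (numEdges H) with h0 | h0
  · simp only [modularityScore, if_pos h0]
    have : (0 : ℝ) ≤ 2 / K := by positivity
    linarith
  have hm : (0 : ℝ) < numEdges H := by exact_mod_cast h0
  have hKr : (0 : ℝ) < K := by exact_mod_cast hK
  rw [modularityScore_labelPartition h0.ne', modularityScore_labelPartition h0.ne']
  have h1 : innerPairs H (fun v => some (l v)) ≤
      innerPairs H (fun v => some (mergeLabel K n L l v)) := by
    refine Finset.sum_le_sum fun u _ => Finset.sum_le_sum fun v _ => ?_
    split_ifs with h h'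
    · exact le_rfl
    · exact absurd ⟨h.1, congrArg some (mergeLabel_congr K (Option.some.inj h.2.1)), by simp⟩ h'
    · norm_num
    · exact le_rfl
  have h2 := div_le_div_of_nonneg_right h1 (by positivity : (0 : ℝ) ≤ 2 * numEdges H)
  have h3 := div_le_div_of_nonneg_right (hL.taxSum_mergeLabel_le h0 hK l)
    (by positivity : (0 : ℝ) ≤ (2 * numEdges H) ^ 2)
  have h4 : (taxSum H l + 2 * (2 * numEdges H) ^ 2 / K) / (2 * numEdges H) ^ 2 =
      taxSum H l / (2 * numEdges H) ^ 2 + 2 / K := by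
    field_simp
  linarith

/-- The merged partition as a labelling with a bounded number of labels. -/
theorem exists_labelPartition_mergeLabel_eq (K : ℕ) (L : List (Fin n × Fin n))
    (l : Fin n → Fin n) :
    ∃ f : Fin n → Fin (K + 1), ∀ G : SimpleGraph (Fin n),
      modularityScore G (labelPartition f) =
        modularityScore G (labelPartition (mergeLabel K n L l)) := by
  classical
  refine ⟨fun v => ⟨mergeLabel K n L l v, Nat.lt_succ_of_le (mergeLabel_le K l v)⟩, fun G => ?_⟩
  by_cases h0 : numEdges G = 0
  · simp [modularityScore, h0]
  · simp only [modularityScore_labelPartition h0, innerPairs, taxSum, Option.some.injEq,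
      Fin.mk.injEq]
    congr! 8
    simp

end Merge

/-! ### Concentration of the number of chosen elements -/

section Concentration

open MeasureTheory ProbabilityTheory

variable {ι : Type*} [Fintype ι]

open scoped Classical in
theorem mgf_card_setBernoulli {u : Set ι} (p : unitInterval) {T : Finset ι} (hT : ↑T ⊆ u) (t : ℝ) :
    mgf (fun S : Set ι => ((T.filter (· ∈ S)).card : ℝ)) (setBernoulli u p) t =
      (1 + p * (Real.exp t - 1)) ^ T.card := by
  have hexp : ∀ x : ι → Prop, Real.exp (t * ((T.filter (· ∈ {i | x i})).card : ℝ)) =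
      ∏ i, if i ∈ T ∧ x i then Real.exp t else 1 := by
    intro x
    rw [mul_comm, Real.exp_nat_mul, Finset.prod_ite, Finset.prod_const_one, mul_one,
      Finset.prod_const]
    congr 2
    ext i; simp
  have hi : ∀ i, ∫ x, (if i ∈ T ∧ x then Real.exp t else 1)
      ∂(unitInterval.toNNReal p • Measure.dirac (i ∈ u) +
        unitInterval.toNNReal (unitInterval.symm p) • Measure.dirac False) =
      if i ∈ T then 1 + p * (Real.exp t - 1) else 1 := by
    intro i
    rw [integral_add_measure (.of_finite) (.of_finite), integral_smul_nnreal_measure,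
      integral_smul_nnreal_measure, integral_dirac, integral_dirac]
    by_cases h : i ∈ T
    · have : i ∈ u := hT h
      simp [h, this, NNReal.smul_def]
      ring
    · simp [h, NNReal.smul_def]
  rw [mgf, setBernoulli_eq_map, integral_map (by fun_prop)
    (Measurable.of_discrete).aestronglyMeasurable]
  simp_rw [hexp]
  rw [Measure.infinitePi_eq_pi,
    integral_fintype_prod_eq_prod (f := fun i (x : Prop) => if i ∈ T ∧ x then Real.exp t else 1)]
  simp_rw [hi]
  rw [Finset.prod_ite, Finset.prod_const_one, mul_one, Finset.prod_const]
  congr 2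
  ext i; simp

open scoped Classical in
/-- The estimate `1 + x ≤ exp x` for the factors, and `exp t - 1 ≤ t + t ^ 2` for `|t| ≤ 1`. -/
theorem mgf_card_setBernoulli_le {u : Set ι} (p : unitInterval) {T : Finset ι} (hT : ↑T ⊆ u)
    {t : ℝ} (ht : |t| ≤ 1) :
    mgf (fun S : Set ι => ((T.filter (· ∈ S)).card : ℝ)) (setBernoulli u p) t ≤
      Real.exp ((p : ℝ) * T.card * (t + t ^ 2)) := by
  have hp := p.2.1
  have h1 : Real.exp t - 1 ≤ t + t ^ 2 := by
    have := (abs_le.1 (Real.abs_exp_sub_one_sub_id_le ht)).2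
    linarith
  have h2 : 0 ≤ 1 + (p : ℝ) * (Real.exp t - 1) := by
    have := Real.exp_pos t
    have := p.2.2
    nlinarith
  rw [mgf_card_setBernoulli p hT,
    show (p : ℝ) * T.card * (t + t ^ 2) = T.card * (p * (t + t ^ 2)) by ring, Real.exp_nat_mul]
  refine pow_le_pow_left₀ h2 ?_ _
  calc 1 + (p : ℝ) * (Real.exp t - 1) ≤ 1 + p * (t + t ^ 2) := by gcongr
    _ ≤ _ := by rw [add_comm]; exact Real.add_one_le_exp _

open scoped Classical in
/-- Chernoff's inequality, with the variance proxy `r`. -/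
theorem setBernoulli_real_abs_sub_le {u : Set ι} (p : unitInterval) {T : Finset ι} (hT : ↑T ⊆ u)
    {r η : ℝ} (hr : (p : ℝ) * T.card ≤ r) (hη : 0 ≤ η) (hη' : η ≤ 1) :
    (setBernoulli u p).real {S | η * r ≤ |((T.filter (· ∈ S)).card : ℝ) - (p : ℝ) * T.card|} ≤
      2 * Real.exp (-(η ^ 2 * r / 4)) := by
  set X : Set ι → ℝ := fun S => ((T.filter (· ∈ S)).card : ℝ)
  have hp := p.2.1
  have hx : 0 ≤ (p : ℝ) * T.card := by positivity
  have hsub : {S | η * r ≤ |X S - (p : ℝ) * T.card|} ⊆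
      {S | (p : ℝ) * T.card + η * r ≤ X S} ∪ {S | X S ≤ (p : ℝ) * T.card - η * r} := by
    intro S hS
    rcases le_abs.1 (show η * r ≤ |X S - (p : ℝ) * T.card| from hS) with h | h
    · left; show _ ≤ X S; linarith
    · right; show X S ≤ _; linarith
  have h1 : (setBernoulli u p).real {S | (p : ℝ) * T.card + η * r ≤ X S} ≤
      Real.exp (-(η ^ 2 * r / 4)) := by
    refine (measure_ge_le_exp_mul_mgf (t := η / 2) _ (by positivity) (.of_finite)).trans ?_
    refine (mul_le_mul_of_nonneg_left (mgf_card_setBernoulli_le p hT (t := η / 2)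
      (by rw [abs_of_nonneg] <;> linarith)) (Real.exp_nonneg _)).trans ?_
    rw [← Real.exp_add, Real.exp_le_exp]
    nlinarith [mul_le_mul_of_nonneg_right hr (sq_nonneg η)]
  have h2 : (setBernoulli u p).real {S | X S ≤ (p : ℝ) * T.card - η * r} ≤
      Real.exp (-(η ^ 2 * r / 4)) := by
    refine (measure_le_le_exp_mul_mgf (t := -(η / 2)) _ (by linarith) (.of_finite)).trans ?_
    refine (mul_le_mul_of_nonneg_left (mgf_card_setBernoulli_le p hT (t := -(η / 2))
      (by rw [abs_neg, abs_of_nonneg] <;> linarith)) (Real.exp_nonneg _)).trans ?_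
    rw [← Real.exp_add, Real.exp_le_exp]
    nlinarith [mul_le_mul_of_nonneg_right hr (sq_nonneg η)]
  calc _ ≤ _ := measureReal_mono hsub
    _ ≤ _ := measureReal_union_le _ _
    _ ≤ _ := by linarith

end Concentration

/-! ### Scores are stable if all counts of inner edges are -/

/-- Replacing `X` by `R` in the denominator costs `η`, since the quotient is at most `1`. -/
theorem abs_div_sub_div_le {A B X R α η : ℝ} (hA : 0 ≤ A) (hAX : A ≤ X) (hX : 0 < X) (hR : 0 < R)
    (h₁ : |A - B| ≤ α * R) (h₂ : |X - R| ≤ η * R) : |A / X - B / R| ≤ α + η := by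
  have e : A / X - B / R = (A - B) / R + A / X * ((R - X) / R) := by
    field_simp
    ring
  have h3 : |(A - B) / R| ≤ α := by rwa [abs_div, abs_of_pos hR, div_le_iff₀ hR]
  have h4 : |(R - X) / R| ≤ η := by rwa [abs_div, abs_of_pos hR, div_le_iff₀ hR, abs_sub_comm]
  have h5 : |A / X| ≤ 1 := by
    rw [abs_of_nonneg (by positivity), div_le_one hX]; exact hAX
  rw [e]
  refine (abs_add_le _ _).trans (add_le_add h3 ?_)
  rw [abs_mul]
  calc |A / X| * |(R - X) / R| ≤ 1 * η := by gcongr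
    _ = η := one_mul η

section Compare

variable {V : Type*} [Fintype V]

open scoped Classical in
/-- The normalized degree tax is the sum of the squares of the relative volumes of the classes. -/
theorem taxSum_div {α : Type*} [Fintype α] [DecidableEq α] (G : SimpleGraph V) (f : V → α)
    (M : ℝ) : taxSum G f / M ^ 2 = ∑ i, ((∑ u, if f u = i then (G.degree u : ℝ) else 0) / M) ^ 2 := by
  simp only [div_pow, ← Finset.sum_div]
  congr 1
  have h : ∀ i, (∑ u, if f u = i then (G.degree u : ℝ) else 0) ^ 2 =
      ∑ u, ∑ v, if f u = i then (if f v = i then (G.degree u : ℝ) * G.degree v else 0) else 0 := by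
    intro i
    rw [pow_two, Finset.sum_mul_sum]
    refine Finset.sum_congr rfl fun u _ => Finset.sum_congr rfl fun v _ => ?_
    split_ifs <;> simp
  simp only [h]
  symm
  rw [taxSum, Finset.sum_comm]
  refine Finset.sum_congr rfl fun u _ => ?_
  rw [Finset.sum_comm]
  refine Finset.sum_congr rfl fun v _ => ?_
  simp [eq_comm]

/-- If all numbers of inner pairs are scaled by about `p`, then so are all volumes, and all scores
are almost equal. -/
theorem abs_modularityScore_sub_le [DecidableEq V] {G H : SimpleGraph V} {K : ℕ} {p η : ℝ}
    (hp : 0 < p) (hG : 0 < numEdges G) (hη : η < 1)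
    (h : ∀ g : V → Option (Fin (K + 1)),
      |innerPairs H g - p * innerPairs G g| ≤ η * (2 * (p * numEdges G)))
    (f : V → Fin (K + 1)) :
    |modularityScore H (labelPartition f) - modularityScore G (labelPartition f)| ≤ 7 * η := by
  classical
  have hm : (0 : ℝ) < numEdges G := by exact_mod_cast hG
  set R : ℝ := 2 * (p * numEdges G) with hR
  have hR0 : 0 < R := by positivity
  have hX : |2 * numEdges H - R| ≤ η * R := by
    have := h fun _ => some 0
    rwa [innerPairs_const, innerPairs_const, mul_left_comm, ← hR] at this
  have hX0 : (0 : ℝ) < 2 * numEdges H := by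
    have := (abs_le.1 hX).1
    nlinarith
  have hH : numEdges H ≠ 0 := by
    intro h0; simp [h0] at hX0
  have hdiv : ∀ x : ℝ, p * x / R = x / (2 * numEdges G) := by
    intro x; rw [hR]; field_simp
  have hinner := abs_div_sub_div_le (innerPairs_nonneg H fun v => some (f v)) (innerPairs_le H _)
    hX0 hR0 (h _) hX
  rw [hdiv] at hinner
  set x : Fin (K + 1) → ℝ := fun i =>
    (∑ u, if f u = i then (H.degree u : ℝ) else 0) / (2 * numEdges H) with hx
  set y : Fin (K + 1) → ℝ := fun i =>
    (∑ u, if f u = i then (G.degree u : ℝ) else 0) / (2 * numEdges G) with hy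
  have hvol0 : ∀ (F : SimpleGraph V) i, 0 ≤ ∑ u, if f u = i then (F.degree u : ℝ) else 0 :=
    fun F i => Finset.sum_nonneg fun u _ => by split_ifs <;> simp
  have hvol1 : ∀ F : SimpleGraph V, ∑ i, ∑ u, (if f u = i then (F.degree u : ℝ) else 0) =
      2 * numEdges F := by
    intro F
    rw [Finset.sum_comm, ← sum_degree]
    simp
  have hxy : ∀ i, |x i - y i| ≤ 5 / 2 * η := by
    intro i
    have e1 := two_mul_sum_degree_eq H (fun u => f u = i) i
    have e2 := two_mul_sum_degree_eq G (fun u => f u = i) i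
    have h1 := abs_le.1 (h fun u => if f u = i then some i else none)
    have h2 := abs_le.1 (h fun u => if f u = i then none else some i)
    have h3 := abs_le.1 hX
    have := abs_div_sub_div_le (hvol0 H i)
      (by rw [← hvol1 H]; exact Finset.single_le_sum (fun j _ => hvol0 H j) (Finset.mem_univ i))
      hX0 hR0 (B := p * ∑ u, if f u = i then (G.degree u : ℝ) else 0) (α := 3 / 2 * η)
      (by
        have e3 : 2 * (p * ∑ u, if f u = i then (G.degree u : ℝ) else 0) =
            R + p * innerPairs G (fun u => if f u = i then some i else none)
              - p * innerPairs G (fun u => if f u = i then none else some i) := by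
          rw [mul_left_comm 2, e2, hR]; ring
        rw [abs_le]; constructor <;> linarith [h1.1, h1.2, h2.1, h2.2, h3.1, h3.2]) hX
    rw [hdiv] at this
    refine this.trans (le_of_eq ?_)
    ring
  have hsx : ∑ i, x i = 1 := by
    rw [hx, ← Finset.sum_div, hvol1, div_self hX0.ne']
  have hsy : ∑ i, y i = 1 := by
    rw [hy, ← Finset.sum_div, hvol1, div_self (by positivity)]
  have htax : |∑ i, x i ^ 2 - ∑ i, y i ^ 2| ≤ 5 * η := by
    rw [← Finset.sum_sub_distrib]
    calc _ ≤ ∑ i, |x i ^ 2 - y i ^ 2| := Finset.abs_sum_le_sum_abs _ _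
      _ ≤ ∑ i, 5 / 2 * η * (x i + y i) := by
          refine Finset.sum_le_sum fun i _ => ?_
          have hi : 0 ≤ x i + y i :=
            add_nonneg (div_nonneg (hvol0 H i) hX0.le) (div_nonneg (hvol0 G i) (by positivity))
          rw [sq_sub_sq, abs_mul, abs_of_nonneg hi, mul_comm]
          exact mul_le_mul_of_nonneg_right (hxy i) hi
      _ = 5 * η := by
          rw [← Finset.mul_sum, Finset.sum_add_distrib, hsx, hsy]; ring
  rw [modularityScore_labelPartition hH, modularityScore_labelPartition hG.ne', taxSum_div,
    taxSum_div]
  rw [abs_le] at hinner htax ⊢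
  constructor <;> linarith [hinner.1, hinner.2, htax.1, htax.2]

end Compare

/-! ### The random subgraph preserves all counts of inner edges -/

section Random

open MeasureTheory ProbabilityTheory

variable {V : Type*} [Fintype V]

/-- A union bound over the `(k + 1) ^ |V|` partial labellings with `k` labels. -/
theorem le_randomSubgraph_real (G : SimpleGraph V) (p : unitInterval) {r η : ℝ} (k : ℕ)
    (hr : (p : ℝ) * numEdges G ≤ r) (hη : 0 ≤ η) (hη' : η ≤ 1) :
    1 - 2 * (k + 1 : ℝ) ^ Fintype.card V * Real.exp (-(η ^ 2 * r / 4)) ≤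
      (randomSubgraph G p).real {H | ∀ g : V → Option (Fin k),
        |innerPairs H g - (p : ℝ) * innerPairs G g| ≤ η * (2 * r)} := by
  classical
  set T : (V → Option (Fin k)) → Finset (Sym2 V) := fun g =>
    G.edgeFinset.filter (· ∈ {e | ∃ i, ∀ v ∈ e, g v = some i}) with hT
  have hTE : ∀ g, ↑(T g) ⊆ G.edgeSet := fun g e he =>
    SimpleGraph.mem_edgeFinset.1 (Finset.mem_filter.1 he).1
  have hTr : ∀ g, (p : ℝ) * (T g).card ≤ r := by
    intro g
    refine le_trans (mul_le_mul_of_nonneg_left ?_ p.2.1) hr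
    rw [numEdges]
    exact_mod_cast Finset.card_filter_le _ _
  set bad : (V → Option (Fin k)) → Set (Set (Sym2 V)) := fun g =>
    {S | η * r ≤ |(((T g).filter (· ∈ S)).card : ℝ) - (p : ℝ) * (T g).card|}
  have hbound : (setBernoulli G.edgeSet p).real (⋃ g, bad g) ≤
      2 * (k + 1 : ℝ) ^ Fintype.card V * Real.exp (-(η ^ 2 * r / 4)) := by
    calc _ ≤ ∑ g, (setBernoulli G.edgeSet p).real (bad g) := measureReal_iUnion_fintype_le _
      _ ≤ ∑ g : V → Option (Fin k), 2 * Real.exp (-(η ^ 2 * r / 4)) :=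
          Finset.sum_le_sum fun g _ => setBernoulli_real_abs_sub_le p (hTE g) (hTr g) hη hη'
      _ = _ := by simp; ring
  have hgood : (setBernoulli G.edgeSet p).real (⋃ g, bad g)ᶜ ≤
      (randomSubgraph G p).real {H | ∀ g : V → Option (Fin k),
        |innerPairs H g - (p : ℝ) * innerPairs G g| ≤ η * (2 * r)} := by
    have hmeas : AEMeasurable (SimpleGraph.fromEdgeSet (V := V)) (setBernoulli G.edgeSet p) :=
      SimpleGraph.measurable_fromEdgeSet.aemeasurable
    have : IsProbabilityMeasure (randomSubgraph G p) :=
      Measure.isProbabilityMeasure_map hmeas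
    refine ENNReal.toReal_mono (measure_ne_top _ _) (le_trans ?_ (Measure.le_map_apply hmeas _))
    refine measure_mono_ae ?_
    filter_upwards [setBernoulli_ae_subset (u := G.edgeSet) (p := p)] with S hS hSb g
    have hSg : S ∉ bad g := fun h => hSb (Set.mem_iUnion.2 ⟨g, h⟩)
    have hlt : _ < η * r := not_le.1 hSg
    have hE : innerPairs (SimpleGraph.fromEdgeSet S) g = 2 * ((T g).filter (· ∈ S)).card := by
      rw [innerPairs_eq_card]
      congr 3
      ext e
      simp only [hT, Finset.mem_filter, SimpleGraph.mem_edgeFinset, SimpleGraph.edgeSet_fromEdgeSet]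
      constructor
      · rintro ⟨⟨h1, -⟩, h2⟩
        exact ⟨⟨hS h1, h2⟩, h1⟩
      · rintro ⟨⟨h1, h2⟩, h3⟩
        exact ⟨⟨h3, G.not_isDiag_of_mem_edgeSet h1⟩, h2⟩
    have hG : innerPairs G g = 2 * (T g).card := by
      rw [innerPairs_eq_card]
      congr!
    rw [hE, hG, mul_left_comm, mul_left_comm η, ← mul_sub,
      abs_mul, abs_two]
    linarith
  have hcompl := probReal_compl_eq_one_sub (μ := setBernoulli G.edgeSet p)
    (s := ⋃ g, bad g) (Set.toFinite _).measurableSet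
  linarith

end Random

/-! ### The choice of constants -/

/-- The summand `1` keeps the threshold positive for all `ε ≤ 1`. -/
theorem isTheta_threshold :
    (fun ε : ℝ => 86016 * (ε⁻¹ ^ 3 * (1 + Real.log ε⁻¹))) =Θ[𝓝[>] (0 : ℝ)]
      fun ε : ℝ => ε⁻¹ ^ 3 * Real.log ε⁻¹ := by
  have hev : ∀ᶠ ε : ℝ in 𝓝[>] (0 : ℝ), 0 < ε ∧ 1 ≤ Real.log ε⁻¹ := by
    filter_upwards [self_mem_nhdsWithin,
      (tendsto_inv_nhdsGT_zero (𝕜 := ℝ)).eventually_ge_atTop (Real.exp 1)] with ε h0 h1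
    exact ⟨h0, (Real.le_log_iff_exp_le (inv_pos.2 h0)).2 h1⟩
  constructor
  · refine IsBigO.of_bound (2 * 86016) ?_
    filter_upwards [hev] with ε ⟨h0, h1⟩
    have : 0 < ε⁻¹ ^ 3 := by positivity
    rw [Real.norm_of_nonneg (by positivity), Real.norm_of_nonneg (by positivity)]
    nlinarith
  · refine IsBigO.of_bound 1 ?_
    filter_upwards [hev] with ε ⟨h0, h1⟩
    have : 0 < ε⁻¹ ^ 3 := by positivity
    rw [Real.norm_of_nonneg (by positivity), Real.norm_of_nonneg (by positivity)]
    nlinarith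

/-- Above the threshold, the number `(K + 2) ^ n` of labellings is beaten by the probability of a
deviation. -/
theorem union_bound_le {ε r : ℝ} {n : ℕ} (h0 : 0 < ε) (h1 : ε < 1) (hn : 0 < n)
    (hr : 86016 * (ε⁻¹ ^ 3 * (1 + Real.log ε⁻¹)) * n ≤ r) :
    2 * ((⌈8 / ε⌉₊ + 1 : ℕ) + 1 : ℝ) ^ n * Real.exp (-((ε / 32) ^ 2 * r / 4)) ≤ ε := by
  have hlog : 0 ≤ Real.log ε⁻¹ := Real.log_nonneg ((one_le_inv₀ h0).2 h1.le)
  have hK : ((⌈8 / ε⌉₊ + 1 : ℕ) + 1 : ℝ) ≤ 11 / ε := by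
    have h2 := (Nat.ceil_lt_add_one (by positivity : 0 ≤ 8 / ε)).le
    have h3 : 1 ≤ 1 / ε := by rw [le_div_iff₀ h0]; linarith
    have h4 : 11 / ε = 8 / ε + 3 * (1 / ε) := by ring
    push_cast
    linarith
  have hexp : Real.exp (-((ε / 32) ^ 2 * r / 4)) ≤ (ε ^ 2 / 22) ^ n := by
    have h2 : (n : ℝ) * (21 + 2 * Real.log ε⁻¹) ≤ (ε / 32) ^ 2 * r / 4 := by
      have h3 := mul_le_mul_of_nonneg_left hr (sq_nonneg ε)
      have h4 : ε ^ 2 * (86016 * (ε⁻¹ ^ 3 * (1 + Real.log ε⁻¹)) * n) =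
          86016 * (1 + Real.log ε⁻¹) * n * ε⁻¹ := by
        field_simp
      have h5 : 86016 * (1 + Real.log ε⁻¹) * n ≤ 86016 * (1 + Real.log ε⁻¹) * n * ε⁻¹ :=
        le_mul_of_one_le_right (by positivity) ((one_le_inv₀ h0).2 h1.le)
      have h6 : 0 ≤ (n : ℝ) * Real.log ε⁻¹ := by positivity
      nlinarith
    calc _ ≤ Real.exp ((n : ℝ) * (-21 + 2 * Real.log ε)) := by
          rw [Real.exp_le_exp]
          rw [Real.log_inv] at h2
          linarith
      _ = (Real.exp (-21 + 2 * Real.log ε)) ^ n := Real.exp_nat_mul _ _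
      _ ≤ _ := by
          refine pow_le_pow_left₀ (Real.exp_nonneg _) ?_ n
          rw [Real.exp_add, two_mul, Real.exp_add, Real.exp_log h0, Real.exp_neg, pow_two,
            div_eq_inv_mul]
          have : (22 : ℝ) ≤ Real.exp 21 := by
            have := Real.add_one_le_exp (21 : ℝ)
            linarith
          gcongr
  calc _ ≤ 2 * (11 / ε) ^ n * (ε ^ 2 / 22) ^ n := by gcongr
    _ = 2 * (ε / 2) ^ n := by
        rw [mul_assoc, ← mul_pow]
        congr 2
        field_simp
        norm_num
    _ ≤ 2 * (ε / 2) ^ 1 := by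
        gcongr 2 * ?_
        exact pow_le_pow_of_le_one (by positivity) (by linarith) hn
    _ = ε := by ring

/-! ### Transfer of modularity and of deficits -/

section Transfer

variable {n K : ℕ} {G H : SimpleGraph (Fin n)} {δ : ℝ}

theorem modularityScore_le_modularity (G : SimpleGraph (Fin n))
    (A : Finpartition (Finset.univ : Finset (Fin n))) : modularityScore G A ≤ modularity G :=
  (isGreatest_modularity G).2 ⟨A, rfl⟩

/-- A graph has nearly optimal partitions with few parts, which is why labellings with boundedly many
labels decide about its modularity. -/
theorem modularity_le_add (hK : 0 < K) (h : ∀ f : Fin n → Fin (K + 1),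
      modularityScore G (labelPartition f) - δ ≤ modularityScore H (labelPartition f)) :
    modularity G ≤ modularity H + δ + 2 / K := by
  obtain ⟨A, hA⟩ := (isGreatest_modularity G).1
  obtain ⟨l, rfl⟩ := exists_labelPartition_eq A
  obtain ⟨L, hL⟩ := exists_isEdgeList G
  obtain ⟨f, hf⟩ := exists_labelPartition_mergeLabel_eq K L l
  have h1 := hL.modularityScore_sub_le hK l
  have h2 := h f
  have h3 := modularityScore_le_modularity H (labelPartition f)
  rw [hf G] at h2
  linarith

theorem deficit_mergeLabel_le (hK : 0 < K) (h : ∀ f : Fin n → Fin (K + 1),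
      |modularityScore H (labelPartition f) - modularityScore G (labelPartition f)| ≤ δ)
    {L : List (Fin n × Fin n)} (hL : IsEdgeList H L) (l : Fin n → Fin n) :
    deficit G (labelPartition (mergeLabel K n L l)) ≤
      deficit H (labelPartition l) + 2 * (δ + 2 / K) := by
  obtain ⟨f, hf⟩ := exists_labelPartition_mergeLabel_eq K L l
  have h1 := hL.modularityScore_sub_le hK l
  have h2 := modularity_le_add (G := G) (H := H) (δ := δ) hK fun f => by
    linarith [(abs_le.1 (h f)).1]
  have h3 := (abs_le.1 (h f)).2
  rw [hf G, hf H] at h3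
  rw [deficit, deficit]
  linarith

end Transfer

end SampledModularity

theorem theorem2 :
    ∃ c : ℝ → ℝ,
      c =Θ[𝓝[>] (0 : ℝ)] (fun ε : ℝ => (ε⁻¹) ^ 3 * Real.log ε⁻¹) ∧
      ∀ ε : ℝ, 0 < ε →
        ∃ F : (n : ℕ) → List (Fin n × Fin n) → (Fin n → Fin n) → Fin n → ℕ,
          SampledModularity.LinearTime F ∧
          ∀ (n : ℕ) (G : SimpleGraph (Fin n)) (p : unitInterval), 0 < p →
            c ε ≤ (SampledModularity.numEdges G : ℝ) * (p : ℝ) / (n : ℝ) →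
            1 - ε ≤ (SampledModularity.randomSubgraph G p).real
              {H : SimpleGraph (Fin n) |
                |SampledModularity.modularity H - SampledModularity.modularity G| < ε ∧
                ∀ (A : Finpartition (Finset.univ : Finset (Fin n))) (l : Fin n → Fin n)
                  (L : List (Fin n × Fin n)),
                  SampledModularity.labelPartition l = A → SampledModularity.IsEdgeList H L →
                    SampledModularity.deficit G (SampledModularity.labelPartition (F n L l)) ≤
                      SampledModularity.deficit H A + ε} := by
  refine ⟨_, SampledModularity.isTheta_threshold, fun ε h0 =>
    ⟨SampledModularity.mergeLabel ⌈8 / ε⌉₊, SampledModularity.linearTime_mergeLabel _,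
      fun n G p hp hc => ?_⟩⟩
  -- For `ε ≥ 1` the claim on the probability is void.
  rcases le_or_gt 1 ε with h1 | h1
  · exact le_trans (by linarith) MeasureTheory.measureReal_nonneg
  have hp' : (0 : ℝ) < p := hp
  have hc0 : 0 < 86016 * (ε⁻¹ ^ 3 * (1 + Real.log ε⁻¹)) := by
    have := Real.log_nonneg ((one_le_inv₀ h0).2 h1.le)
    positivity
  -- Division by `0` gives `0`, so that the hypothesis on the density excludes `n = 0`.
  have hn : 0 < n := by
    rcases Nat.eq_zero_or_pos n with rfl | hn
    · simp only [Nat.cast_zero, div_zero] at hc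
      linarith
    · exact hn
  have hn' : (0 : ℝ) < n := by exact_mod_cast hn
  have hr := (le_div_iff₀ hn').1 hc
  rw [mul_comm (SampledModularity.numEdges G : ℝ)] at hr
  have hG : 0 < SampledModularity.numEdges G := by
    rcases Nat.eq_zero_or_pos (SampledModularity.numEdges G) with h | h
    · rw [h, Nat.cast_zero, mul_zero] at hr
      exact absurd hr (not_le.2 (by positivity))
    · exact h
  have hK : 0 < ⌈8 / ε⌉₊ := Nat.ceil_pos.2 (by positivity)
  have hK' : (2 : ℝ) / ⌈8 / ε⌉₊ ≤ ε / 4 := by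
    have := Nat.le_ceil (8 / ε)
    rw [div_le_iff₀ (by exact_mod_cast hK)]
    calc (2 : ℝ) = ε / 4 * (8 / ε) := by field_simp; norm_num
      _ ≤ _ := by gcongr
  have hprob := SampledModularity.le_randomSubgraph_real G p (⌈8 / ε⌉₊ + 1) le_rfl
    (by positivity : 0 ≤ ε / 32) (by linarith)
  rw [Fintype.card_fin] at hprob
  have hsmall := SampledModularity.union_bound_le h0 h1 hn hr
  have : MeasureTheory.IsProbabilityMeasure (SampledModularity.randomSubgraph G p) :=
    MeasureTheory.Measure.isProbabilityMeasure_map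
      SimpleGraph.measurable_fromEdgeSet.aemeasurable
  refine (show _ ≤ _ by linarith : (1 - ε) ≤ _).trans (hprob.trans
    (MeasureTheory.measureReal_mono fun H hH => ?_))
  have hscore : ∀ f : Fin n → Fin (⌈8 / ε⌉₊ + 1),
      |SampledModularity.modularityScore H (SampledModularity.labelPartition f) -
        SampledModularity.modularityScore G (SampledModularity.labelPartition f)| ≤ ε * (7 / 32) :=
    fun f => (SampledModularity.abs_modularityScore_sub_le hp' hG (by linarith) hH f).trans
      (by linarith)
  have hGH := SampledModularity.modularity_le_add (G := G) (H := H) (δ := ε * (7 / 32)) hK fun f => by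
    linarith [(abs_le.1 (hscore f)).1]
  have hHG := SampledModularity.modularity_le_add (G := H) (H := G) (δ := ε * (7 / 32)) hK fun f => by
    linarith [(abs_le.1 (hscore f)).2]
  refine ⟨abs_lt.2 ⟨by linarith, by linarith⟩, ?_⟩
  rintro A l L rfl hL
  have := SampledModularity.deficit_mergeLabel_le hK hscore hL l
  linarith
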